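/- **Setting.** Let $K$ be a field. A persistence module for a poset $P$ is a functor from $P$ (as a thin category) to $K$-vector spaces. A translation of $P$ is a monotone map $\Lambda:P\to P$ with $\Lambda p\ge p$ for all $p$; write $(F\Lambda)(p)=F(\Lambda p)$. A $(\Gamma,\Lambda)$-interleaving between $F$ and $G$ is a pair of morphisms $\varphi:F\to G\Lambda$, $\psi:G\to F\Gamma$ such that, for all $p\in P$, $\psi_{\Lambda p}\circ\varphi_p=F(p\le\Gamma\Lambda p)$ and $\varphi_{\Gamma p}\circ\psi_p=G(p\le\Lambda\Gamma p)$. For persistence modules $I,M$ for $\mathbb R$, let $D(I,M)\in[0,\infty]$ be the classical interleaving distance, the infimum of all real $\varepsilon\ge0$ for which $I$ and $M$ are interleaved by the translations $\Gamma=\Lambda=(t\mapsto t+\varepsilon)$. For a finite set $X\subset\mathbb R$ let $X^+=X\cup\{\infty\}$, and fix a real number $b_X>0$. Let $d$ be the weighted graph metric on the Hasse diagram of $X^+$ in which an edge between consecutive points $x<x'$ of $X$ has weight $x'-x$ and the edge from $\max X$ to $\infty$ has weight $b_X$. The height of a translation $\Lambda$ of $X^+$ is $h(\Lambda)=\sup_{p\in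 X^+}d(p,\Lambda p)$. Persistence modules for $X$ are regarded as modules for $X^+$ that vanish at $\infty$, and for two of them $D^X(F,G)$ is the infimum of all $\varepsilon$ for which there is a $(\Gamma,\Lambda)$-interleaving between $F$ and $G$ over $X^+$ with $h(\Gamma),h(\Lambda)\le\varepsilon$. Let $\delta^XI$ be the restriction of a persistence module $I$ for $\mathbb R$ to $X$. Let $L\subset\mathbb R$ be finite. We say that the endpoints of a persistence module $I$ for $\mathbb R$ lie in $L$ if $I(t)=0$ whenever $t<l$ for all $l\in L$, and $I(s\le t)$ is an isomorphism whenever $s\le t$ and $(s,t]\cap L=\emptyset$. (So $I$ is constant on the intervals $[l,l')$ between consecutive points of $L$ and on $[\max L,\infty)$, where it may be nonzero.) Let $\Delta$ be the set of finite supersets of $L$ in $\mathbb R$, directed by inclusion. **Theorem.** For all persistence modules $I,M$ for $\mathbb R$ whose endpoints lie in $L$, $$\lim_{X\in\Delta}D^X(\delta^XI,\delta^XM)=D(I,M)\quad\text{in }[0,\infty].$$ The convergence is uniform in the modules: for all real $\gamma>0$ and $N\ge0$ there is $Y\in\Delta$ such that for every $X\in\Delta$ with $X\supseteq Y$ and all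 $I,M$ whose endpoints lie in $L$, $$|D^X(\delta^XI,\delta^XM)-D(I,M)|\le\gamma\ \text{ if }D(I,M)<\infty,\qquad D^X(\delta^XI,\delta^XM)\ge N\ \text{ if }D(I,M)=\infty.$$ -/

import Mathlib

open CategoryTheory CategoryTheory.Limits Filter Topology
open scoped NNReal ENNReal

universe u w

noncomputable section

/-- A generalized persistence module for the poset `P` with values in `K`-vector spaces:
a functor from `P`, seen as a thin category, to `K`-vector spaces. -/
abbrev PersistenceModule (K : Type u) [Field K] (P : Type) [Preorder P] :=
  P ⥤ ModuleCat.{w} K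

/-- A translation of `P`: a monotone self-map `Λ` with `p ≤ Λ p` for all `p`. -/
structure Translation (P : Type) [Preorder P] extends P →o P where
  le_apply : ∀ p, p ≤ toFun p

namespace Translation

variable {P : Type} [Preorder P]

instance : CoeFun (Translation P) (fun _ => P → P) := ⟨fun Λ => Λ.toFun⟩

/-- A translation as an endofunctor of the thin category `P`. -/
def functor (Λ : Translation P) : P ⥤ P := Λ.monotone'.functor

/-- The height of `Λ` with respect to the distance `d`: the supremum of `d p (Λ p)`. -/
def height (d : P → P → ℝ≥0∞) (Λ : Translation P) : ℝ≥0∞ := ⨆ p, d p (Λ p)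

/-- The translation `t ↦ t + ε` of the real line. -/
def shift (ε : ℝ≥0) : Translation ℝ where
  toFun t := t + ε
  monotone' _ _ h := add_le_add_left h _
  le_apply _ := le_add_of_nonneg_right ε.2

end Translation

section Interleaving

variable {K : Type u} [Field K] {P : Type} [Preorder P]

/-- The right action of translations: `(F · Λ)(p) = F(Λ p)`. -/
abbrev PersistenceModule.act (F : PersistenceModule.{u, w} K P) (Λ : Translation P) :
    PersistenceModule.{u, w} K P :=
  Λ.functor ⋙ F

/-- There is a `(Γ, Λ)`-interleaving between `F` and `G`: morphisms `φ : F ⟶ GΛ`, `ψ : G ⟶ FΓ`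
for which both triangles commute. -/
def Interleaved (Γ Λ : Translation P) (F G : PersistenceModule.{u, w} K P) : Prop :=
  ∃ (φ : F ⟶ G.act Λ) (ψ : G ⟶ F.act Γ),
    (∀ p, φ.app p ≫ ψ.app (Λ p) =
      F.map (homOfLE ((Λ.le_apply p).trans (Γ.le_apply (Λ p))))) ∧
    (∀ p, ψ.app p ≫ φ.app (Γ p) =
      G.map (homOfLE ((Γ.le_apply p).trans (Λ.le_apply (Γ p)))))

/-- The interleaving distance on persistence modules for `P` that comes from a distance `d` on `P`.
It is `∞` if there is no interleaving of finite height. -/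
def interleavingDist (d : P → P → ℝ≥0∞) (F G : PersistenceModule.{u, w} K P) : ℝ≥0∞ :=
  sInf {ε | ∃ Γ Λ : Translation P, Γ.height d ≤ ε ∧ Λ.height d ≤ ε ∧ Interleaved Γ Λ F G}

/-- The classical interleaving distance for modules over the real line: the infimum of all `ε`
such that `F` and `G` are interleaved by the shifts by `ε`. -/
def classicalDist (F G : PersistenceModule.{u, w} K ℝ) : ℝ≥0∞ :=
  sInf {ε | ∃ e : ℝ≥0, ε = e ∧ Interleaved (.shift e) (.shift e) F G}

/-- A module for `P` seen as the module for `P⁺ = P ∪ {∞}` that is zero at `∞`. -/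
def PersistenceModule.extendZero (F : PersistenceModule.{u, w} K P) :
    PersistenceModule.{u, w} K (WithTop P) where
  obj p := match p with
    | (p : P) => F.obj p
    | ⊤ => ModuleCat.of K PUnit
  map {p q} f := match p, q, f with
    | (p : P), (q : P), f => F.map (homOfLE (WithTop.coe_le_coe.1 (leOfHom f)))
    | _, ⊤, _ => 0
    | ⊤, (_ : P), _ => 0
  map_id p := by
    cases p with
    | top => exact (ModuleCat.isZero_of_subsingleton (ModuleCat.of K PUnit)).eq_of_src _ _
    | coe p => exact F.map_id p
  map_comp {p q r} f g := by
    cases r with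
    | top => exact (ModuleCat.isZero_of_subsingleton (ModuleCat.of K PUnit)).eq_of_tgt _ _
    | coe r =>
      cases q with
      | top => exact absurd (leOfHom g) (WithTop.not_top_le_coe r)
      | coe q =>
        cases p with
        | top => exact absurd (leOfHom f) (WithTop.not_top_le_coe q)
        | coe p =>
          exact F.map_comp (homOfLE (WithTop.coe_le_coe.1 (leOfHom f)))
            (homOfLE (WithTop.coe_le_coe.1 (leOfHom g)))

end Interleaving

section Discretization

/-- The weights of the edges of the Hasse quiver of `X ∪ {∞}`: an edge between consecutive points of
`X` has their distance as weight, the edge from the maximum of `X` to `∞` has weight `b`. -/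
def edgeWeight (X : Finset ℝ) (b : ℝ) : WithTop X → WithTop X → ℝ≥0∞
  | (x : X), (y : X) => ENNReal.ofReal |(x : ℝ) - y|
  | (_ : X), ⊤ => ENNReal.ofReal b
  | ⊤, (_ : X) => ENNReal.ofReal b
  | ⊤, ⊤ => 0

/-- The weighted graph metric on the Hasse quiver of `X ∪ {∞}`: the infimum, over all walks from `p`
to `q`, of the sum of the weights of the edges of the walk. -/
def graphDist (X : Finset ℝ) (b : ℝ) (p q : WithTop X) : ℝ≥0∞ :=
  ⨅ γ : (SimpleGraph.hasse (WithTop X)).Walk p q,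
    (γ.darts.map fun e => edgeWeight X b e.fst e.snd).sum

variable {K : Type u} [Field K]

/-- The restriction of a module over the real line to the finite set `X`. -/
def discretize (X : Finset ℝ) (F : PersistenceModule.{u, w} K ℝ) :
    PersistenceModule.{u, w} K X :=
  (Subtype.mono_coe (· ∈ X)).functor ⋙ F

/-- The interleaving distance `D^X` on modules for the finite totally ordered set `X`: they are seen
as modules for `X ∪ {∞}`, which carries the weighted graph metric. -/
def discreteDist (X : Finset ℝ) (b : ℝ) (F G : PersistenceModule.{u, w} K X) : ℝ≥0∞ :=
  interleavingDist (graphDist X b) F.extendZero G.extendZero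

/-- The endpoints of `F` lie in `L`: `F` vanishes before all points of `L`, and it changes only at
points of `L`, that is, `F(s ≤ t)` is an isomorphism if no point of `L` lies in `(s, t]`. So `F` is
constant on the half-open intervals `[l, l')` between consecutive points of `L`, and on
`[max L, ∞)`, where it need not be zero. -/
structure HasEndpointsIn (L : Finset ℝ) (F : PersistenceModule.{u, w} K ℝ) : Prop where
  isZero : ∀ t : ℝ, (∀ l ∈ L, t < l) → IsZero (F.obj t)
  isIso : ∀ (s t : ℝ) (h : s ≤ t), (∀ l ∈ L, ¬ (s < l ∧ l ≤ t)) → IsIso (F.map (homOfLE h))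

/-- The directed set of finite supersets of `L`, ordered by inclusion. -/
abbrev FiniteSupersets (L : Finset ℝ) := {X : Finset ℝ // L ⊆ X}

end Discretization

end

/-! A module with endpoints in `L` only sees which points of `L` lie below `s`: its value at `s` is
its value at the largest such point, or zero. So the maps `F s ⟶ G t` of an interleaving can be
carried between the line and `X` in both directions.

Upper bound (`discreteDist_le_add`): replace the shift by `e` with `x ↦` the largest point of `X`
below `x + e + γ`. If `X` contains `L` and a `γ`-fine mesh of its range, this rounding loses no
endpoint, even after composing. The height is at most `e + γ`, and only `∞` goes to `∞`, so
vanishing there kills nothing.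

Lower bound (`classicalDist_le_discreteDist`): let `X` have a point far above `L`. A translation of
height below `N` then sends no point near or below `L` to `∞`, whatever the weight of the last edge,
and the maps out of `F l`, `l ∈ L`, determine an interleaving by shifts. Heights beyond `N` are
harmless: by `classicalDist_le_width` a finite distance is at most the width of `L`, so `N` is taken
at least that large.

Mesh and far point depend only on `L`, `γ`, `N`; hence the uniformity. -/

noncomputable section

/-! ### Interleavings as families of maps indexed by a relation -/

section Transfer

variable {K : Type u} [Field K] {P : Type} [Preorder P]

/-- The structure map `F p ⟶ F q` of a persistence module for `p ≤ q`. -/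
def PersistenceModule.res (F : PersistenceModule.{u, w} K P) {p q : P} (h : p ≤ q) :
    F.obj p ⟶ F.obj q :=
  F.map (homOfLE h)

theorem PersistenceModule.res_res (F : PersistenceModule.{u, w} K P) {p q r : P}
    (h : p ≤ q) (h' : q ≤ r) : F.res h ≫ F.res h' = F.res (h.trans h') :=
  (F.map_comp _ _).symm

theorem PersistenceModule.res_res_assoc (F : PersistenceModule.{u, w} K P) {p q r : P}
    (h : p ≤ q) (h' : q ≤ r) {Z : ModuleCat.{w} K} (f : F.obj r ⟶ Z) :
    F.res h ≫ F.res h' ≫ f = F.res (h.trans h') ≫ f := by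
  rw [← Category.assoc, F.res_res]

/-- A family of maps `F p ⟶ G q`, one for each related pair `(p, q)`, compatible with the
structure maps of `F` and `G`. -/
structure Transfer (R : P → P → Prop) (F G : PersistenceModule.{u, w} K P) where
  app : ∀ {p q : P}, R p q → (F.obj p ⟶ G.obj q)
  res_app : ∀ {p p' q : P} (h : p ≤ p') (hr : R p' q) (hr' : R p q),
    F.res h ≫ app hr = app hr'
  app_res : ∀ {p q q' : P} (h : q ≤ q') (hr : R p q) (hr' : R p q'),
    app hr ≫ G.res h = app hr'

namespace Transfer

variable {F G : PersistenceModule.{u, w} K P} {R S : P → P → Prop}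

theorem res_app_assoc (Φ : Transfer R F G) {p p' q : P} (h : p ≤ p') (hr : R p' q)
    (hr' : R p q) {Z : ModuleCat.{w} K} (f : G.obj q ⟶ Z) :
    F.res h ≫ Φ.app hr ≫ f = Φ.app hr' ≫ f := by
  rw [← Category.assoc, Φ.res_app h hr hr']

theorem app_res_assoc (Φ : Transfer R F G) {p q q' : P} (h : q ≤ q') (hr : R p q)
    (hr' : R p q') {Z : ModuleCat.{w} K} (f : G.obj q' ⟶ Z) :
    Φ.app hr ≫ G.res h ≫ f = Φ.app hr' ≫ f := by
  rw [← Category.assoc, Φ.app_res h hr hr']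

/-- Restriction of a transfer to a smaller relation. -/
def ofImp (hS : ∀ {p q}, S p q → R p q) (Φ : Transfer R F G) : Transfer S F G where
  app h := Φ.app (hS h)
  res_app h _ _ := Φ.res_app h _ _
  app_res h _ _ := Φ.app_res h _ _

/-- The composite of two transfers is the structure map of `F`. -/
def CompEqRes (Φ : Transfer R F G) (Ψ : Transfer S G F) : Prop :=
  ∀ {p q r : P} (h : R p q) (h' : S q r) (hpr : p ≤ r), Φ.app h ≫ Ψ.app h' = F.res hpr

/-- The component `F p ⟶ G (Λ p)` of a morphism `F ⟶ GΛ`. -/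
def component {Λ : Translation P} (φ : F ⟶ G.act Λ) (p : P) : F.obj p ⟶ G.obj (Λ p) :=
  φ.app p

theorem res_component {Λ : Translation P} (φ : F ⟶ G.act Λ) {p q : P} (h : p ≤ q) :
    F.res h ≫ component φ q = component φ p ≫ G.res (Λ.monotone h) :=
  φ.naturality (homOfLE h)

/-- A morphism `F ⟶ GΛ` gives maps `F p ⟶ G q` whenever `Λ p ≤ q`. -/
def ofHom {Λ : Translation P} (φ : F ⟶ G.act Λ) : Transfer (fun p q => Λ p ≤ q) F G where
  app {p _} h := component φ p ≫ G.res h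
  res_app h _ _ := by rw [← Category.assoc, res_component, Category.assoc, G.res_res]
  app_res _ _ _ := by rw [Category.assoc, G.res_res]

theorem compEqRes_ofHom {Γ Λ : Translation P} (φ : F ⟶ G.act Λ) (ψ : G ⟶ F.act Γ)
    (H : ∀ p, φ.app p ≫ ψ.app (Λ p) =
      F.map (homOfLE ((Λ.le_apply p).trans (Γ.le_apply (Λ p))))) :
    CompEqRes (ofHom φ) (ofHom ψ) := by
  intro p q r h h' hpr
  have H' : component φ p ≫ component ψ (Λ p) = F.res _ := H p
  have := (ofHom ψ).res_app h h' ((Γ.monotone h).trans h')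
  change (component φ p ≫ G.res h) ≫ (ofHom ψ).app h' = _
  rw [Category.assoc, this]
  change component φ p ≫ component ψ (Λ p) ≫ F.res _ = _
  rw [← Category.assoc, H', F.res_res]

/-- Transfers along `Λ p ≤ q` come from morphisms `F ⟶ GΛ`. -/
def toHom {Λ : Translation P} (Φ : Transfer (fun p q => Λ p ≤ q) F G) : F ⟶ G.act Λ where
  app p := Φ.app (le_refl (Λ p))
  naturality _ _ f :=
    (Φ.res_app (leOfHom f) _ (Λ.monotone' (leOfHom f))).trans
      (Φ.app_res (Λ.monotone' (leOfHom f)) _ _).symm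

theorem interleaved {Γ Λ : Translation P} (Φ : Transfer (fun p q => Λ p ≤ q) F G)
    (Ψ : Transfer (fun p q => Γ p ≤ q) G F) (h : CompEqRes Φ Ψ) (h' : CompEqRes Ψ Φ) :
    Interleaved Γ Λ F G :=
  ⟨Φ.toHom, Ψ.toHom, fun _ => h _ _ _, fun _ => h' _ _ _⟩

end Transfer

theorem Interleaved.exists_transfer {Γ Λ : Translation P} {F G : PersistenceModule.{u, w} K P}
    (H : Interleaved Γ Λ F G) :
    ∃ (Φ : Transfer (fun p q => Λ p ≤ q) F G) (Ψ : Transfer (fun p q => Γ p ≤ q) G F),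
      Φ.CompEqRes Ψ ∧ Ψ.CompEqRes Φ := by
  obtain ⟨φ, ψ, h, h'⟩ := H
  exact ⟨.ofHom φ, .ofHom ψ, Transfer.compEqRes_ofHom φ ψ h, Transfer.compEqRes_ofHom ψ φ h'⟩

namespace Transfer

variable {F G : PersistenceModule.{u, w} K P}

/-- Restriction to `P` of a transfer between modules extended by zero. -/
def ofExtendZero {R : WithTop P → WithTop P → Prop} (Φ : Transfer R F.extendZero G.extendZero) :
    Transfer (fun p q : P => R p q) F G where
  app h := Φ.app h
  res_app {_ _ _} h hr hr' := Φ.res_app (WithTop.coe_le_coe.2 h) hr hr'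
  app_res {_ _ _} h hr hr' := Φ.app_res (WithTop.coe_le_coe.2 h) hr hr'

/-- Extension by zero of a transfer along `lam p ≤ q`. -/
def extendZero {lam : P → P} (Φ : Transfer (fun p q => lam p ≤ q) F G) :
    Transfer (fun p q : WithTop P => p.map lam ≤ q) F.extendZero G.extendZero where
  app {p q} h := match p, q, h with
    | (p : P), (q : P), h => Φ.app (p := p) (q := q) (WithTop.coe_le_coe.1 h)
    | _, ⊤, _ => 0
    | ⊤, (_ : P), _ => 0
  res_app {p p' q} h hr hr' := by
    cases q with
    | top => exact (ModuleCat.isZero_of_subsingleton (ModuleCat.of K PUnit)).eq_of_tgt _ _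
    | coe q =>
      cases p' with
      | top => exact absurd hr (WithTop.not_top_le_coe q)
      | coe p' =>
        cases p with
        | top => exact absurd h (WithTop.not_top_le_coe p')
        | coe p => exact Φ.res_app (WithTop.coe_le_coe.1 h) _ _
  app_res {p q q'} h hr hr' := by
    cases q' with
    | top => exact (ModuleCat.isZero_of_subsingleton (ModuleCat.of K PUnit)).eq_of_tgt _ _
    | coe q' =>
      cases q with
      | top => exact absurd h (WithTop.not_top_le_coe q')
      | coe q =>
        cases p with
        | top => exact absurd hr (WithTop.not_top_le_coe q)
        | coe p => exact Φ.app_res (WithTop.coe_le_coe.1 h) _ _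

theorem CompEqRes.extendZero {lam lam' : P → P} {Φ : Transfer (fun p q => lam p ≤ q) F G}
    {Ψ : Transfer (fun p q => lam' p ≤ q) G F} (H : Φ.CompEqRes Ψ) :
    Φ.extendZero.CompEqRes Ψ.extendZero := by
  intro p q r h h' hpr
  cases r with
  | top => exact (ModuleCat.isZero_of_subsingleton (ModuleCat.of K PUnit)).eq_of_tgt _ _
  | coe r =>
    cases q with
    | top => exact absurd h' (WithTop.not_top_le_coe r)
    | coe q =>
      cases p with
      | top => exact absurd h (WithTop.not_top_le_coe q)
      | coe p => exact H _ _ (WithTop.coe_le_coe.1 hpr)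

end Transfer

/-- The extension to `P ∪ {∞}` of a translation of `P`. -/
def Translation.withTop (Λ : Translation P) : Translation (WithTop P) where
  toFun p := p.map Λ
  monotone' := Λ.monotone'.withTop_map
  le_apply p := by
    cases p with
    | top => exact le_rfl
    | coe p => exact WithTop.coe_le_coe.2 (Λ.le_apply p)

end Transfer

/-! ### Comparing the graph metric with distances on the line -/

section GraphDist

theorem graphDist_self (X : Finset ℝ) (b : ℝ) (p : WithTop X) : graphDist X b p p = 0 :=
  le_antisymm (iInf_le_of_le SimpleGraph.Walk.nil (by simp)) zero_le

/-- The weights along the consecutive points from `x` up to `y` telescope. -/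
theorem graphDist_le_of_le (X : Finset ℝ) (b : ℝ) {x y : X} (h : x ≤ y) :
    graphDist X b x y ≤ ENNReal.ofReal ((y : ℝ) - x) := by
  induction y using WellFoundedLT.induction with
  | _ y ih =>
    rcases h.eq_or_lt with rfl | h
    · simp [graphDist_self]
    · obtain ⟨z, hxz, hzy⟩ := exists_le_covBy_of_lt h
      have hadj : (SimpleGraph.hasse (WithTop X)).Adj (z : WithTop X) (y : WithTop X) :=
        Or.inl (WithTop.coe_covBy_coe.2 hzy)
      have hle : graphDist X b x y ≤ graphDist X b x z + ENNReal.ofReal ((y : ℝ) - z) := by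
        unfold graphDist
        rw [ENNReal.iInf_add]
        refine le_iInf fun γ => iInf_le_of_le (γ.concat hadj) ?_
        simp only [SimpleGraph.Walk.darts_concat, List.concat_eq_append, List.map_append,
          List.sum_append, List.map_cons, List.map_nil, List.sum_cons, List.sum_nil, add_zero]
        gcongr
        change ENNReal.ofReal |(z : ℝ) - y| ≤ _
        rw [abs_sub_comm, abs_of_nonneg (sub_nonneg.2 (Subtype.coe_le_coe.2 hzy.le))]
      refine hle.trans ((add_le_add_left (ih z hzy.lt hxz) _).trans ?_)
      have h1 : (x : ℝ) ≤ z := hxz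
      have h2 : (z : ℝ) ≤ y := hzy.le
      rw [← ENNReal.ofReal_add (by linarith) (by linarith)]
      exact ENNReal.ofReal_le_ofReal (by linarith)

/-- A function that is nonexpansive along the edges is nonexpansive for the graph metric. -/
theorem ofReal_sub_le_graphDist {X : Finset ℝ} {b : ℝ} (f : WithTop X → ℝ)
    (hf : ∀ p q, (SimpleGraph.hasse (WithTop X)).Adj p q →
      ENNReal.ofReal (f q - f p) ≤ edgeWeight X b p q) (p q : WithTop X) :
    ENNReal.ofReal (f q - f p) ≤ graphDist X b p q := by
  refine le_iInf fun γ => ?_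
  induction γ with
  | nil => simp
  | @cons p q r h γ ih =>
    have : f r - f p = (f q - f p) + (f r - f q) := by ring
    rw [this]
    refine ENNReal.ofReal_add_le.trans ?_
    simpa using add_le_add (hf _ _ h) ih

/-- The inclusion of `X` into the line, where `∞` goes to `c`. -/
def position (X : Finset ℝ) (c : ℝ) : WithTop X → ℝ
  | (x : X) => x
  | ⊤ => c

/-- With `∞` placed at `max X`, the last edge has length zero on the line, so the bound holds for
every `b`. -/
theorem position_sub_le_graphDist {X : Finset ℝ} {b c : ℝ} (hc : c ∈ X)
    (hmax : ∀ x ∈ X, x ≤ c) (p q : WithTop X) :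
    ENNReal.ofReal (position X c q - position X c p) ≤ graphDist X b p q := by
  -- Only the maximum of `X` is covered by `∞`.
  have key : ∀ x : X, (x : WithTop X) ⋖ ⊤ → (x : ℝ) = c := fun x hx =>
    le_antisymm (hmax x x.2) (not_lt.1 fun hlt =>
      hx.2 (c := ((⟨c, hc⟩ : X) : WithTop X)) (WithTop.coe_lt_coe.2 hlt) (WithTop.coe_lt_top _))
  refine ofReal_sub_le_graphDist _ (fun p q h => ?_) p q
  cases p with
  | top =>
    cases q with
    | top => simp
    | coe y =>
      rcases h with h | h
      · exact absurd h.lt not_top_lt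
      · simp [position, key y h]
  | coe x =>
    cases q with
    | top =>
      rcases h with h | h
      · simp [position, key x h]
      · exact absurd h.lt not_top_lt
    | coe y =>
      change ENNReal.ofReal ((y : ℝ) - x) ≤ ENNReal.ofReal |(x : ℝ) - y|
      rw [abs_sub_comm]
      exact ENNReal.ofReal_le_ofReal (le_abs_self _)

end GraphDist

/-! ### Extending maps between modules with endpoints in `L` -/

section Endpoints

variable {K : Type u} [Field K] {L : Finset ℝ} {F G : PersistenceModule.{u, w} K ℝ}

theorem Finset.exists_greatest_le {X : Finset ℝ} {s : ℝ} (h : ∃ x ∈ X, x ≤ s) :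
    ∃ x ∈ X, x ≤ s ∧ ∀ y ∈ X, y ≤ s → y ≤ x := by
  obtain ⟨x, hx, hxs⟩ := h
  obtain ⟨m, hm, hmax⟩ :=
    (X.filter (· ≤ s)).exists_max_image id ⟨x, Finset.mem_filter.2 ⟨hx, hxs⟩⟩
  rw [Finset.mem_filter] at hm
  exact ⟨m, hm.1, hm.2, fun y hy hys => hmax y (Finset.mem_filter.2 ⟨hy, hys⟩)⟩

namespace HasEndpointsIn

theorem isIso_res (hF : HasEndpointsIn L F) {s t : ℝ} (h : s ≤ t)
    (H : ∀ l ∈ L, l ≤ t → l ≤ s) : IsIso (F.res h) :=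
  hF.isIso s t h fun l hl hst => (H l hl hst.2).not_gt hst.1

theorem isZero_of_not_exists (hF : HasEndpointsIn L F) {s : ℝ} (h : ¬ ∃ l ∈ L, l ≤ s) :
    IsZero (F.obj s) :=
  hF.isZero s fun l hl => not_le.1 fun hle => h ⟨l, hl, hle⟩

/-- The maps `F l ⟶ F s` with `l ∈ L` are jointly epimorphic. -/
theorem hom_ext (hF : HasEndpointsIn L F) {s : ℝ} {Z : ModuleCat.{w} K} {f g : F.obj s ⟶ Z}
    (h : ∀ l ∈ L, ∀ hl : l ≤ s, F.res hl ≫ f = F.res hl ≫ g) : f = g := by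
  by_cases hs : ∃ l ∈ L, l ≤ s
  · obtain ⟨l, hl, hls, hmax⟩ := Finset.exists_greatest_le hs
    have := hF.isIso_res hls hmax
    exact (cancel_epi (F.res hls)).1 (h l hl hls)
  · exact (hF.isZero_of_not_exists hs).eq_of_src _ _

/-- Compatible maps `F l ⟶ Z`, for `l ∈ L` with `l ≤ s`, extend to `F s`. -/
theorem exists_desc (hF : HasEndpointsIn L F) {s : ℝ} {Z : ModuleCat.{w} K}
    (c : ∀ l ∈ L, l ≤ s → (F.obj l ⟶ Z))
    (hc : ∀ l l' (hl : l ∈ L) (hl' : l' ∈ L) (h : l ≤ l') (hs : l' ≤ s),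
      F.res h ≫ c l' hl' hs = c l hl (h.trans hs)) :
    ∃ f : F.obj s ⟶ Z, ∀ l (hl : l ∈ L) (hls : l ≤ s), F.res hls ≫ f = c l hl hls := by
  by_cases hs : ∃ l ∈ L, l ≤ s
  · obtain ⟨m, hm, hms, hmax⟩ := Finset.exists_greatest_le hs
    have := hF.isIso_res hms hmax
    refine ⟨inv (F.res hms) ≫ c m hm hms, fun l hl hls => ?_⟩
    rw [← F.res_res (hmax l hl hls) hms, Category.assoc, IsIso.hom_inv_id_assoc, hc]
  · exact ⟨0, fun l hl hls => absurd ⟨l, hl, hls⟩ hs⟩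

/-- Maps out of `F s` into `G t` are determined by their composites with `G t ⟶ G u`, if `F s = 0`
or `G` does not change between `t` and `u`. -/
theorem eq_of_comp_res (hF : HasEndpointsIn L F) (hG : HasEndpointsIn L G) {s t u : ℝ}
    (htu : t ≤ u) (H : (∃ l ∈ L, l ≤ s) → ∀ l ∈ L, l ≤ u → l ≤ t) {f g : F.obj s ⟶ G.obj t}
    (h : f ≫ G.res htu = g ≫ G.res htu) : f = g := by
  by_cases hs : ∃ l ∈ L, l ≤ s
  · have := hG.isIso_res htu (H hs)
    exact (cancel_mono (G.res htu)).1 h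
  · exact (hF.isZero_of_not_exists hs).eq_of_src _ _

/-- Maps from `F s` to `G u` lift along `G t ⟶ G u`, if `F s = 0` or `G` does not change between
`t` and `u`. -/
theorem exists_lift (hF : HasEndpointsIn L F) (hG : HasEndpointsIn L G) {s t u : ℝ}
    (htu : t ≤ u) (H : (∃ l ∈ L, l ≤ s) → ∀ l ∈ L, l ≤ u → l ≤ t) (g : F.obj s ⟶ G.obj u) :
    ∃ f : F.obj s ⟶ G.obj t, f ≫ G.res htu = g := by
  by_cases hs : ∃ l ∈ L, l ≤ s
  · have := hG.isIso_res htu (H hs)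
    exact ⟨g ≫ inv (G.res htu), by simp⟩
  · exact ⟨0, (hF.isZero_of_not_exists hs).eq_of_src _ _⟩

end HasEndpointsIn

namespace Transfer

/-- A transfer between discretizations as a transfer along a relation between points of `X`. -/
def ofDiscretize {X : Finset ℝ} {R : X → X → Prop}
    (Φ : Transfer R (discretize X F) (discretize X G)) :
    Transfer (fun s t => ∃ (hs : s ∈ X) (ht : t ∈ X), R ⟨s, hs⟩ ⟨t, ht⟩) F G where
  app h := Φ.app h.snd.snd
  res_app {s s' t} h hr hr' :=
    Φ.res_app (p := ⟨s, hr'.fst⟩) (p' := ⟨s', hr.fst⟩) (q := ⟨t, hr.snd.fst⟩) h _ _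
  app_res {s t t'} h hr hr' :=
    Φ.app_res (p := ⟨s, hr.fst⟩) (q := ⟨t, hr.snd.fst⟩) (q' := ⟨t', hr'.snd.fst⟩) h _ _

/-- Restriction of a transfer to the points of `X`. -/
def toDiscretize {X : Finset ℝ} {R : ℝ → ℝ → Prop} {S : X → X → Prop}
    (hS : ∀ {x y : X}, S x y → R x y) (Φ : Transfer R F G) :
    Transfer S (discretize X F) (discretize X G) where
  app h := Φ.app (hS h)
  res_app h hr hr' := Φ.res_app (Subtype.coe_le_coe.2 h) (hS hr) (hS hr')
  app_res h hr hr' := Φ.app_res (Subtype.coe_le_coe.2 h) (hS hr) (hS hr')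

/-- A transfer that is defined on `L` and shifts by at most `e` induces a transfer along
`s + e ≤ t`. -/
theorem exists_shift {R : ℝ → ℝ → Prop} {e : ℝ} (hF : HasEndpointsIn L F)
    (Φ : Transfer R F G) (hR : ∀ l ∈ L, ∀ x y, l ≤ x → R x y → R l y)
    (hL : ∀ l ∈ L, ∃ y, R l y ∧ y ≤ l + e) :
    ∃ Φ' : Transfer (fun s t => s + e ≤ t) F G, ∀ {x y s t : ℝ} (h : R x y) (hxs : x ≤ s)
      (hyt : y ≤ t) (hst : s + e ≤ t), F.res hxs ≫ Φ'.app hst = Φ.app h ≫ G.res hyt := by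
  -- Of two targets of `l` one lies below the other, so the induced map into `G t` does not depend
  -- on the choice of target.
  have coherent : ∀ {l y y' t} (h : R l y) (h' : R l y') (hy : y ≤ t) (hy' : y' ≤ t),
      Φ.app h ≫ G.res hy = Φ.app h' ≫ G.res hy' := by
    intro l y y' t h h' hy hy'
    rcases le_total y y' with hle | hle
    · rw [← G.res_res hle hy', Φ.app_res_assoc hle h h']
    · rw [← G.res_res hle hy, Φ.app_res_assoc hle h' h]
  choose y hy hye using hL
  have hyt : ∀ {s t} (_ : s + e ≤ t) l (hl : l ∈ L), l ≤ s → y l hl ≤ t :=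
    fun hst l hl hls => (hye l hl).trans (by linarith)
  have hex : ∀ s t (hst : s + e ≤ t), ∃ f : F.obj s ⟶ G.obj t, ∀ l (hl : l ∈ L) (hls : l ≤ s),
      F.res hls ≫ f = Φ.app (hy l hl) ≫ G.res (hyt hst l hl hls) := fun s t hst =>
    hF.exists_desc _ fun l l' hl hl' h hs => by
      rw [Φ.res_app_assoc h _ (hR l hl _ _ h (hy l' hl'))]
      exact coherent _ _ _ _
  choose f hf using hex
  have key : ∀ {x y s t : ℝ} (h : R x y) (hxs : x ≤ s) (hyt : y ≤ t) (hst : s + e ≤ t),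
      F.res hxs ≫ f s t hst = Φ.app h ≫ G.res hyt := by
    intro x y s t h hxs hyt hst
    refine hF.hom_ext fun l hl hlx => ?_
    rw [F.res_res_assoc, hf s t hst l hl, Φ.res_app_assoc hlx h (hR l hl _ _ hlx h)]
    exact coherent _ _ _ _
  refine ⟨⟨fun {s t} hst => f s t hst, fun {s s' t} h hr hr' => ?_, fun {s t t'} h hr hr' => ?_⟩,
    key⟩
  · refine hF.hom_ext fun l hl hls => ?_
    rw [F.res_res_assoc, hf _ _ hr l hl, hf _ _ hr' l hl]
  · refine hF.hom_ext fun l hl hls => ?_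
    rw [← Category.assoc, hf _ _ hr l hl, hf _ _ hr' l hl, Category.assoc, G.res_res]

/-- It suffices to test on `F l`, where both composites run through `l → y → z`, and `z ≤ l + 2e`
leaves room below the final point. -/
theorem CompEqRes.of_shift {R S : ℝ → ℝ → Prop} {e : ℝ}
    (hF : HasEndpointsIn L F) {Φ : Transfer R F G} {Ψ : Transfer S G F} (H : Φ.CompEqRes Ψ)
    (hL : ∀ l ∈ L, ∃ y z, R l y ∧ S y z ∧ l ≤ z ∧ y ≤ l + e ∧ z ≤ y + e)
    {Φ' : Transfer (fun s t => s + e ≤ t) F G} {Ψ' : Transfer (fun s t => s + e ≤ t) G F}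
    (hΦ : ∀ {x y s t : ℝ} (h : R x y) (hxs : x ≤ s) (hyt : y ≤ t) (hst : s + e ≤ t),
      F.res hxs ≫ Φ'.app hst = Φ.app h ≫ G.res hyt)
    (hΨ : ∀ {x y s t : ℝ} (h : S x y) (hxs : x ≤ s) (hyt : y ≤ t) (hst : s + e ≤ t),
      G.res hxs ≫ Ψ'.app hst = Ψ.app h ≫ F.res hyt) :
    Φ'.CompEqRes Ψ' := by
  intro s t u hst htu hsu
  refine hF.hom_ext fun l hl hls => ?_
  obtain ⟨y, z, hly, hyz, hlz, hye, hze⟩ := hL l hl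
  rw [← Category.assoc, hΦ hly hls (by linarith) hst, Category.assoc,
    hΨ hyz _ (by linarith) htu, ← Category.assoc, H hly hyz hlz, F.res_res, F.res_res]

/-- The relation along which a transfer that shifts by `e` extends between modules with endpoints
in `L`. -/
def ShiftRel (L : Finset ℝ) (e s t : ℝ) : Prop :=
  (∃ l ∈ L, l ≤ s) → ∀ l ∈ L, l ≤ s + e → l ≤ t

theorem ShiftRel.le_max {e s t : ℝ} (h : ShiftRel L e s t) (hs : ∃ l ∈ L, l ≤ s) :
    ∀ l ∈ L, l ≤ max t (s + e) → l ≤ t := fun l hl hle =>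
  (le_max_iff.1 hle).elim id (h hs l hl)

/-- Go from `F s` to `G (max t (s + e))`, then lift back to `G t`: either `F s = 0` or `G` has no
endpoint in between. The target may thus lie below `s + e`. -/
theorem exists_extend {e : ℝ} (hF : HasEndpointsIn L F) (hG : HasEndpointsIn L G)
    (Φ : Transfer (fun s t => s + e ≤ t) F G) :
    ∃ Φ' : Transfer (ShiftRel L e) F G, ∀ {s t u : ℝ} (h : ShiftRel L e s t) (htu : t ≤ u)
      (hsu : s + e ≤ u), Φ'.app h ≫ G.res htu = Φ.app hsu := by
  have hex : ∀ s t (h : ShiftRel L e s t), ∃ f : F.obj s ⟶ G.obj t,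
      f ≫ G.res (le_max_left t (s + e)) = Φ.app (le_max_right t (s + e)) :=
    fun s t h => hF.exists_lift hG _ h.le_max _
  choose f hf using hex
  have key : ∀ {s t u : ℝ} (h : ShiftRel L e s t) (htu : t ≤ u) (hsu : s + e ≤ u),
      f s t h ≫ G.res htu = Φ.app hsu := by
    intro s t u h htu hsu
    rw [← G.res_res (le_max_left t (s + e)) (max_le htu hsu), ← Category.assoc, hf, Φ.app_res]
  refine ⟨⟨fun {s t} h => f s t h, fun {s s' t} h hr hr' => ?_, fun {s t t'} h hr hr' => ?_⟩, key⟩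
  · refine hF.eq_of_comp_res hG (le_max_left t (s' + e))
      (fun ⟨l, hl, hls⟩ => hr.le_max ⟨l, hl, hls.trans h⟩) ?_
    have hle : s + e ≤ max t (s' + e) := (by linarith : s + e ≤ s' + e).trans (le_max_right _ _)
    rw [Category.assoc, hf, key hr' _ hle, Φ.res_app h]
  · refine hF.eq_of_comp_res hG (le_max_left t' (s + e)) hr'.le_max ?_
    rw [Category.assoc, G.res_res, hf, key hr _ (le_max_right _ _)]

/-- Past `max t (s + e) + e` the extended maps agree with the given ones, so the triangle commutes
there. By `hu` it can be pulled back to `u`. -/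
theorem extend_comp_extend {e : ℝ} (he : 0 ≤ e) (hF : HasEndpointsIn L F)
    {Φ : Transfer (fun s t => s + e ≤ t) F G} {Ψ : Transfer (fun s t => s + e ≤ t) G F}
    (H : Φ.CompEqRes Ψ) {Φ' : Transfer (ShiftRel L e) F G} {Ψ' : Transfer (ShiftRel L e) G F}
    (hΦ : ∀ {s t u : ℝ} (h : ShiftRel L e s t) (htu : t ≤ u) (hsu : s + e ≤ u),
      Φ'.app h ≫ G.res htu = Φ.app hsu)
    (hΨ : ∀ {s t u : ℝ} (h : ShiftRel L e s t) (htu : t ≤ u) (hsu : s + e ≤ u),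
      Ψ'.app h ≫ F.res htu = Ψ.app hsu)
    {s t u : ℝ} (hst : ShiftRel L e s t) (htu : ShiftRel L e t u) (hsu : s ≤ u)
    (hu : (∃ l ∈ L, l ≤ s) → ∀ l ∈ L, l ≤ max t (s + e) + e → l ≤ u) :
    Φ'.app hst ≫ Ψ'.app htu = F.res hsu := by
  have ht := le_max_left t (s + e)
  have hs := le_max_right t (s + e)
  refine hF.eq_of_comp_res hF (le_max_left u (max t (s + e) + e))
    (fun hs l hl hle => (le_max_iff.1 hle).elim id (hu hs l hl)) ?_
  have hv := le_max_right u (max t (s + e) + e)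
  have htv : t + e ≤ max u (max t (s + e) + e) := by linarith
  rw [Category.assoc, hΨ htu _ htv, ← Ψ.res_app ht hv htv, ← Category.assoc, hΦ hst ht hs,
    H hs hv (by linarith), F.res_res]

end Transfer

end Endpoints

/-! ### The two inequalities between the distances -/

section Distances

variable {K : Type u} [Field K] {L : Finset ℝ} {F G : PersistenceModule.{u, w} K ℝ}

theorem classicalDist_le_of_interleaved {e : ℝ≥0} (h : Interleaved (.shift e) (.shift e) F G) :
    classicalDist F G ≤ e :=
  sInf_le ⟨e, rfl, h⟩

/-- If the interleaving distance is finite, it is at most the length of an interval that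
contains all endpoints. -/
theorem classicalDist_le_width {a m : ℝ} {d : ℝ≥0} (hd : m ≤ a + d) (ha : ∀ l ∈ L, a ≤ l)
    (hm : ∀ l ∈ L, l ≤ m) (hF : HasEndpointsIn L F) (hG : HasEndpointsIn L G)
    (hfin : classicalDist F G ≠ ⊤) : classicalDist F G ≤ d := by
  obtain ⟨_, ⟨e, rfl, hI⟩, -⟩ := sInf_lt_iff.1 (lt_top_iff_ne_top.2 hfin)
  obtain ⟨Φ, Ψ, h, h'⟩ := hI.exists_transfer
  change Transfer (fun s t : ℝ => s + (e : ℝ) ≤ t) F G at Φ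
  change Transfer (fun s t : ℝ => s + (e : ℝ) ≤ t) G F at Ψ
  obtain ⟨Φ', hΦ⟩ := Φ.exists_extend hF hG
  obtain ⟨Ψ', hΨ⟩ := Ψ.exists_extend hG hF
  -- A point past some endpoint is at least `a`, so a shift by `d` takes it past all of `L`.
  have late : ∀ {s t : ℝ}, s + d ≤ t → (∃ l ∈ L, l ≤ s) → ∀ l ∈ L, l ≤ t := by
    rintro s t hst ⟨l₀, hl₀, hls⟩ l hl
    linarith [ha l₀ hl₀, hm l hl]
  have hrel : ∀ {s t : ℝ}, s + d ≤ t → Transfer.ShiftRel L e s t :=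
    fun hst hs l hl _ => late hst hs l hl
  have late₂ : ∀ {s t u : ℝ}, s + d ≤ t → t + d ≤ u → (∃ l ∈ L, l ≤ s) → ∀ l ∈ L, l ≤ u :=
    fun hst htu hs l hl => (late hst hs l hl).trans (by linarith [d.2])
  refine classicalDist_le_of_interleaved
    (Transfer.interleaved (Γ := .shift d) (Λ := .shift d) (Φ'.ofImp hrel) (Ψ'.ofImp hrel) ?_ ?_)
  · intro s t u hst htu hsu
    exact Transfer.extend_comp_extend e.2 hF h hΦ hΨ (hrel hst) (hrel htu) hsu
      fun hs l hl _ => late₂ hst htu hs l hl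
  · intro s t u hst htu hsu
    exact Transfer.extend_comp_extend e.2 hG h' hΨ hΦ (hrel hst) (hrel htu) hsu
      fun hs l hl _ => late₂ hst htu hs l hl

/-- Rounding down, unlike rounding up, always stays inside `X`. -/
theorem exists_floorShift (X : Finset ℝ) (c : ℝ≥0) :
    ∃ Λ : Translation X, ∀ x : X, (Λ x : ℝ) ≤ x + c ∧ ∀ y ∈ X, y ≤ (x : ℝ) + c → y ≤ Λ x := by
  have hex : ∀ x : X, ∃ y ∈ X, y ≤ (x : ℝ) + c ∧ ∀ z ∈ X, z ≤ (x : ℝ) + c → z ≤ y := fun x =>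
    Finset.exists_greatest_le ⟨x, x.2, le_add_of_nonneg_right c.2⟩
  choose f hfX hfle hfmax using hex
  refine ⟨⟨⟨fun x => ⟨f x, hfX x⟩, fun x x' h => ?_⟩, fun x => ?_⟩,
    fun x => ⟨hfle x, hfmax x⟩⟩
  · have h' : (x : ℝ) ≤ x' := h
    exact hfmax x' _ (hfX x) ((hfle x).trans (by linarith))
  · exact hfmax x _ x.2 (le_add_of_nonneg_right c.2)

theorem height_withTop_le {X : Finset ℝ} {b : ℝ} {c : ℝ≥0} {Λ : Translation X}
    (h : ∀ x : X, (Λ x : ℝ) ≤ x + c) : Λ.withTop.height (graphDist X b) ≤ c := by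
  refine iSup_le fun p => ?_
  cases p with
  | top => exact (graphDist_self X b ⊤).trans_le zero_le
  | coe x =>
    refine (graphDist_le_of_le X b (Λ.le_apply x)).trans ?_
    rw [ENNReal.ofReal_le_iff_le_toReal ENNReal.coe_ne_top, ENNReal.coe_toReal]
    linarith [h x]

theorem discreteDist_le_add {a m b : ℝ} {γ : ℝ≥0} {X : Finset ℝ} (hLX : L ⊆ X)
    (ha : ∀ l ∈ L, a ≤ l) (hm : ∀ l ∈ L, l ≤ m)
    (hX : ∀ u, a ≤ u + γ → u ≤ m → ∃ y ∈ X, u ≤ y ∧ y ≤ u + γ)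
    (hF : HasEndpointsIn L F) (hG : HasEndpointsIn L G) :
    discreteDist X b (discretize X F) (discretize X G) ≤ classicalDist F G + γ := by
  rw [classicalDist, ENNReal.sInf_add]
  refine le_iInf₂ ?_
  rintro _ ⟨e, rfl, hI⟩
  obtain ⟨Φ, Ψ, h, h'⟩ := hI.exists_transfer
  change Transfer (fun s t : ℝ => s + (e : ℝ) ≤ t) F G at Φ
  change Transfer (fun s t : ℝ => s + (e : ℝ) ≤ t) G F at Ψ
  obtain ⟨Φ', hΦ⟩ := Φ.exists_extend hF hG
  obtain ⟨Ψ', hΨ⟩ := Ψ.exists_extend hG hF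
  obtain ⟨Λ, hΛ⟩ := exists_floorShift X (e + γ)
  have hγ : (0 : ℝ) ≤ γ := γ.2
  have he : (0 : ℝ) ≤ e := e.2
  have hΛ' : ∀ {x y : X}, Λ x ≤ y → ∀ l ∈ L, l ≤ (x : ℝ) + e + γ → l ≤ y :=
    fun {x y} hxy l hl hle => ((hΛ x).2 l (hLX hl) (by push_cast; linarith)).trans hxy
  have hrel : ∀ {x y : X}, Λ x ≤ y → Transfer.ShiftRel L e x y :=
    fun hxy _ l hl hle => hΛ' hxy l hl (by linarith)
  -- If `y` falls short of `x + e`, the second shift could lose endpoints. A mesh point just above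
  -- `x + e` rules this out while `x + e ≤ m`; beyond `m` the first shift has already passed all of
  -- `L`.
  have hlate : ∀ {x y z : X}, Λ x ≤ y → Λ y ≤ z → (∃ l ∈ L, l ≤ (x : ℝ)) →
      ∀ l ∈ L, l ≤ max (y : ℝ) (x + e) + e → l ≤ z := by
    rintro x y z hxy hyz ⟨l₀, hl₀, hlx⟩ l hl hle
    have hyz' : (y : ℝ) ≤ z := (Λ.le_apply y).trans hyz
    rcases le_total ((x : ℝ) + e) y with hxe | hxe
    · rw [max_eq_left hxe] at hle
      exact hΛ' hyz l hl (by linarith)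
    · rcases le_total ((x : ℝ) + e) m with hxm | hxm
      · obtain ⟨v, hv, hxv, hve⟩ := hX (x + e) (by linarith [ha l₀ hl₀]) hxm
        have hvy : v ≤ y := ((hΛ x).2 v hv (by push_cast; linarith)).trans hxy
        rw [max_eq_right hxe] at hle
        exact hΛ' hyz l hl (by linarith)
      · exact (hΛ' hxy l hl (by linarith [hm l hl])).trans hyz'
  have hheight : Λ.withTop.height (graphDist X b) ≤ (e : ℝ≥0∞) + γ := by
    have := height_withTop_le (b := b) fun x => (hΛ x).1
    rwa [ENNReal.coe_add] at this
  refine sInf_le ⟨Λ.withTop, Λ.withTop, hheight, hheight, ?_⟩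
  refine Transfer.interleaved (Γ := Λ.withTop) (Λ := Λ.withTop)
    (Φ'.toDiscretize hrel).extendZero (Ψ'.toDiscretize hrel).extendZero
    (Transfer.CompEqRes.extendZero ?_) (Transfer.CompEqRes.extendZero ?_)
  · intro x y z hxy hyz hxz
    exact Transfer.extend_comp_extend he hF h hΦ hΨ (hrel hxy) (hrel hyz) hxz (hlate hxy hyz)
  · intro x y z hxy hyz hxz
    exact Transfer.extend_comp_extend he hG h' hΨ hΦ (hrel hxy) (hrel hyz) hxz (hlate hxy hyz)

/-- A translation of height at most `e` does not reach `∞` from points further than `e` below some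
point of `X`. -/
theorem exists_coe_eq_of_height_le {X : Finset ℝ} {b c : ℝ} {e : ℝ≥0}
    {Λ : Translation (WithTop X)} (h : Λ.height (graphDist X b) ≤ e) (hc : c ∈ X) {x : X}
    (hx : (x : ℝ) + e < c) : ∃ y : X, Λ x = y ∧ (y : ℝ) ≤ x + e := by
  obtain ⟨M, hM, hmax⟩ := X.exists_max_image id ⟨c, hc⟩
  have hd := (position_sub_le_graphDist (b := b) hM hmax x (Λ x)).trans
    ((le_iSup (fun p => graphDist X b p (Λ p)) x).trans h)
  rw [ENNReal.ofReal_le_iff_le_toReal ENNReal.coe_ne_top, ENNReal.coe_toReal] at hd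
  have hcM : c ≤ M := hmax c hc
  cases hΛ : Λ x with
  | top =>
    rw [hΛ] at hd
    change M - (x : ℝ) ≤ e at hd
    linarith
  | coe y =>
    rw [hΛ] at hd
    change (y : ℝ) - x ≤ e at hd
    exact ⟨y, rfl, by linarith⟩

/-- Two translations of height `ε < N` take a point of `L` at most to `m + 2ε < c`, so the
interleaving is never cut off by the zero at `∞`. -/
theorem classicalDist_le_discreteDist {m b c : ℝ} {N : ℝ≥0} {X : Finset ℝ} (hLX : L ⊆ X)
    (hm : ∀ l ∈ L, l ≤ m) (hc : c ∈ X) (hmc : m + 2 * N ≤ c)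
    (hF : HasEndpointsIn L F) (hG : HasEndpointsIn L G)
    (hN : discreteDist X b (discretize X F) (discretize X G) < N) :
    classicalDist F G ≤ discreteDist X b (discretize X F) (discretize X G) := by
  refine le_of_forall_gt fun r hr => ?_
  obtain ⟨ε, ⟨Γ, Λ, hΓ, hΛ, hI⟩, hε⟩ := sInf_lt_iff.1 (lt_min hr hN)
  rw [lt_min_iff] at hε
  lift ε to ℝ≥0 using (hε.2.trans ENNReal.coe_lt_top).ne
  refine (classicalDist_le_of_interleaved ?_).trans_lt hε.1
  have hεN : (ε : ℝ) < N := by exact_mod_cast hε.2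
  obtain ⟨Φ, Ψ, h, h'⟩ := hI.exists_transfer
  -- The range up to `m + ε` covers the second translation, which starts where the first one ended.
  have step : ∀ {Λ : Translation (WithTop X)}, Λ.height (graphDist X b) ≤ ε → ∀ x : X,
      (x : ℝ) ≤ m + ε → ∃ y : X, Λ x ≤ y ∧ (x : ℝ) ≤ y ∧ (y : ℝ) ≤ x + ε := by
    intro Λ hΛ x hx
    obtain ⟨y, hy, hyx⟩ := exists_coe_eq_of_height_le hΛ hc (x := x) (by linarith)
    exact ⟨y, hy.le, Subtype.coe_le_coe.2 (WithTop.coe_le_coe.1 ((Λ.le_apply x).trans hy.le)), hyx⟩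
  have mono : ∀ {Λ : Translation (WithTop X)}, ∀ l ∈ L, ∀ x y : ℝ, l ≤ x →
      (∃ (hs : x ∈ X) (ht : y ∈ X), Λ ((⟨x, hs⟩ : X) : WithTop X) ≤ ((⟨y, ht⟩ : X) : WithTop X)) →
      ∃ (hs : l ∈ X) (ht : y ∈ X), Λ ((⟨l, hs⟩ : X) : WithTop X) ≤ ((⟨y, ht⟩ : X) : WithTop X) := by
    rintro Λ l hl x y hlx ⟨hs, ht, hxy⟩
    exact ⟨hLX hl, ht, (Λ.monotone (WithTop.coe_le_coe.2 hlx)).trans hxy⟩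
  have near : ∀ l ∈ L, l ≤ m + ε := fun l hl => (hm l hl).trans (le_add_of_nonneg_right ε.2)
  have one : ∀ {Λ : Translation (WithTop X)}, Λ.height (graphDist X b) ≤ ε → ∀ l ∈ L, ∃ y,
      (∃ (hs : l ∈ X) (ht : y ∈ X),
        Λ ((⟨l, hs⟩ : X) : WithTop X) ≤ ((⟨y, ht⟩ : X) : WithTop X)) ∧ y ≤ l + ε := by
    intro Λ hΛ l hl
    obtain ⟨y, hy, -, hyl⟩ := step hΛ ⟨l, hLX hl⟩ (near l hl)
    exact ⟨y, ⟨hLX hl, y.2, hy⟩, hyl⟩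
  have two : ∀ {Γ Λ : Translation (WithTop X)}, Γ.height (graphDist X b) ≤ ε →
      Λ.height (graphDist X b) ≤ ε → ∀ l ∈ L, ∃ y z,
      (∃ (hs : l ∈ X) (ht : y ∈ X),
        Λ ((⟨l, hs⟩ : X) : WithTop X) ≤ ((⟨y, ht⟩ : X) : WithTop X)) ∧
      (∃ (hs : y ∈ X) (ht : z ∈ X),
        Γ ((⟨y, hs⟩ : X) : WithTop X) ≤ ((⟨z, ht⟩ : X) : WithTop X)) ∧
      l ≤ z ∧ y ≤ l + ε ∧ z ≤ y + ε := by
    intro Γ Λ hΓ hΛ l hl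
    obtain ⟨y, hy, hly, hyl⟩ := step hΛ ⟨l, hLX hl⟩ (near l hl)
    change l ≤ (y : ℝ) at hly
    change (y : ℝ) ≤ l + ε at hyl
    obtain ⟨z, hz, hyz, hzy⟩ := step hΓ y (by linarith [hm l hl])
    exact ⟨y, z, ⟨hLX hl, y.2, hy⟩, ⟨y.2, z.2, hz⟩, hly.trans hyz, hyl, hzy⟩
  obtain ⟨Φ', hΦ⟩ := Φ.ofExtendZero.ofDiscretize.exists_shift hF mono (one hΛ)
  obtain ⟨Ψ', hΨ⟩ := Ψ.ofExtendZero.ofDiscretize.exists_shift hG mono (one hΓ)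
  refine Transfer.interleaved (Γ := .shift ε) (Λ := .shift ε) Φ' Ψ' ?_ ?_
  · refine Transfer.CompEqRes.of_shift hF ?_ (two hΓ hΛ) hΦ hΨ
    rintro s t r ⟨hs, ht, hst⟩ ⟨-, hr, htr⟩ hsr
    exact h hst htr (WithTop.coe_le_coe.2 hsr)
  · refine Transfer.CompEqRes.of_shift hG ?_ (two hΛ hΓ) hΨ hΦ
    rintro s t r ⟨hs, ht, hst⟩ ⟨-, hr, htr⟩ hsr
    exact h' hst htr (WithTop.coe_le_coe.2 hsr)

/-- Round `u` up to the grid `a + γℕ`; below `a`, the point `a` itself serves. -/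
theorem exists_mesh (a m : ℝ) {γ : ℝ≥0} (hγ : 0 < γ) :
    ∃ Z : Finset ℝ, ∀ u, a ≤ u + γ → u ≤ m → ∃ y ∈ Z, u ≤ y ∧ y ≤ u + γ := by
  have hγ' : (0 : ℝ) < γ := hγ
  refine ⟨(Finset.range (⌈(m - a) / γ⌉₊ + 1)).image fun k : ℕ => a + k * γ, fun u hau hum => ?_⟩
  have hle : (u - a) / γ ≤ (m - a) / γ := by gcongr
  refine ⟨a + ⌈(u - a) / γ⌉₊ * γ, Finset.mem_image_of_mem _ (Finset.mem_range.2
    (Nat.lt_succ_of_le (Nat.ceil_mono hle))), ?_, ?_⟩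
  · have := (div_le_iff₀ hγ').1 (Nat.le_ceil ((u - a) / γ))
    linarith
  · rcases le_total a u with h | h
    · have := Nat.ceil_lt_add_one (div_nonneg (sub_nonneg.2 h) hγ'.le)
      have h2 : (⌈(u - a) / γ⌉₊ : ℝ) * γ ≤ ((u - a) / γ + 1) * γ := by gcongr
      rw [add_mul, div_mul_cancel₀ _ hγ'.ne'] at h2
      linarith
    · rw [Nat.ceil_eq_zero.2 (div_nonpos_of_nonpos_of_nonneg (sub_nonpos.2 h) hγ'.le)]
      simpa using hau

/-- The discrete interleaving distances converge uniformly to the classical one. -/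
theorem exists_uniform_bound (K : Type u) [Field K] (L : Finset ℝ) (b : Finset ℝ → ℝ)
    {γ : ℝ≥0} (N : ℝ≥0) (hγ : 0 < γ) :
    ∃ Y : FiniteSupersets L, ∀ X : FiniteSupersets L, Y ≤ X →
      ∀ I M : PersistenceModule.{u, w} K ℝ, HasEndpointsIn L I → HasEndpointsIn L M →
        (classicalDist I M ≠ ⊤ →
          discreteDist X.1 (b X.1) (discretize X.1 I) (discretize X.1 M)
            ≤ classicalDist I M + γ ∧
          classicalDist I M
            ≤ discreteDist X.1 (b X.1) (discretize X.1 I) (discretize X.1 M) + γ) ∧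
        (classicalDist I M = ⊤ →
          N ≤ discreteDist X.1 (b X.1) (discretize X.1 I) (discretize X.1 M)) := by
  obtain ⟨a, ha⟩ := L.bddBelow
  obtain ⟨m, hm⟩ := L.bddAbove
  obtain ⟨Z, hZ⟩ := exists_mesh a m hγ
  let d : ℝ≥0 := (m - a).toNNReal
  have hd : m ≤ a + d := by linarith [Real.le_coe_toNNReal (m - a)]
  -- The bound `max N d` serves both cases: `d` when the distance is finite, `N` when it is
  -- infinite.
  let c : ℝ := m + 2 * (max N d : ℝ≥0)
  refine ⟨⟨insert c (L ∪ Z), Finset.subset_union_left.trans (Finset.subset_insert _ _)⟩,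
    fun X hX I M hI hM => ?_⟩
  have hcX : c ∈ X.1 := hX (Finset.mem_insert_self _ _)
  have hZX : Z ⊆ X.1 :=
    (Finset.subset_union_right.trans (Finset.subset_insert _ _)).trans hX
  have lower := classicalDist_le_discreteDist (b := b X.1) (N := max N d) X.2
    (fun l hl => hm hl) hcX le_rfl hI hM
  refine ⟨fun hfin => ⟨discreteDist_le_add X.2 (fun l hl => ha hl) (fun l hl => hm hl)
    (fun u hau hum => (hZ u hau hum).imp fun y hy => ⟨hZX hy.1, hy.2⟩) hI hM, ?_⟩, fun htop => ?_⟩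
  · refine le_add_right ?_
    by_cases h : discreteDist X.1 (b X.1) (discretize X.1 I) (discretize X.1 M) < (max N d : ℝ≥0)
    · exact lower h
    · exact (classicalDist_le_width hd (fun l hl => ha hl) (fun l hl => hm hl) hI hM hfin).trans
        ((ENNReal.coe_le_coe.2 (le_max_right N d)).trans (not_lt.1 h))
  · by_contra h
    have h' := (not_le.1 h).trans_le (ENNReal.coe_le_coe.2 (le_max_left N d))
    exact (h'.trans ENNReal.coe_lt_top).not_ge (htop.symm.le.trans (lower h'))

end Distances

end

/-! ### Convergence from the uniform bound -/

theorem theorem2 {K : Type u} [Field K] (L : Finset ℝ)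
    (b : Finset ℝ → ℝ) (hb : ∀ X, 0 < b X) :
    (∀ I M : PersistenceModule.{u, w} K ℝ, HasEndpointsIn L I → HasEndpointsIn L M →
      Tendsto
        (fun X : FiniteSupersets L =>
          discreteDist X.1 (b X.1) (discretize X.1 I) (discretize X.1 M))
        atTop (𝓝 (classicalDist I M))) ∧
    (∀ γ N : ℝ≥0, 0 < γ → ∃ Y : FiniteSupersets L, ∀ X : FiniteSupersets L, Y ≤ X →
      ∀ I M : PersistenceModule.{u, w} K ℝ, HasEndpointsIn L I → HasEndpointsIn L M →
        (classicalDist I M ≠ ⊤ →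
          discreteDist X.1 (b X.1) (discretize X.1 I) (discretize X.1 M)
            ≤ classicalDist I M + γ ∧
          classicalDist I M
            ≤ discreteDist X.1 (b X.1) (discretize X.1 I) (discretize X.1 M) + γ) ∧
        (classicalDist I M = ⊤ →
          N ≤ discreteDist X.1 (b X.1) (discretize X.1 I) (discretize X.1 M))) := by
  refine ⟨fun I M hI hM => ?_, fun γ N hγ => exists_uniform_bound K L b N hγ⟩
  by_cases hfin : classicalDist I M = ⊤
  · rw [hfin, ENNReal.tendsto_nhds_top_iff_nnreal]
    intro N
    -- Neighbourhoods of `∞` ask for a strict inequality, hence `N + 1`; any positive `γ` will do.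
    obtain ⟨Y, hY⟩ := exists_uniform_bound.{u, w} K L b (N + 1) one_pos
    filter_upwards [eventually_ge_atTop Y] with X hX
    refine lt_of_lt_of_le ?_ ((hY X hX I M hI hM).2 hfin)
    exact_mod_cast lt_add_one N
  · rw [ENNReal.tendsto_nhds hfin]
    intro ε hε
    obtain ⟨γ, hγ, hγε⟩ := ENNReal.lt_iff_exists_nnreal_btwn.1 hε
    obtain ⟨Y, hY⟩ := exists_uniform_bound.{u, w} K L b 0 (ENNReal.coe_pos.1 hγ)
    filter_upwards [eventually_ge_atTop Y] with X hX
    obtain ⟨h, h'⟩ := (hY X hX I M hI hM).1 hfin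
    exact ⟨tsub_le_iff_right.2 (h'.trans (add_le_add_right hγε.le _)),
      h.trans (add_le_add_right hγε.le _)⟩
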